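/- **Termination of Peterson's mutual exclusion algorithm.** *Language.* Over a type $\alpha$ of states, programs are generated by $$p ::= \mathsf{skip}\mid \mathsf{basic}\,f\mid \mathsf{cjump}\,C\,i\,p\mid \mathsf{while}\,C\,p\,p\mid \mathsf{if}\,C\,p\,p\mid p;p\mid \parallel(p_1,\dots,p_m)\ (m\ge 1)\mid \mathsf{await}\,C\,p,$$ with $f:\alpha\to\alpha$, $C\subseteq\alpha$, labels $i\in\mathbb N$; write $p\parallel q$ for $\parallel(p,q)$, let $;$ associate to the right, and let $\mathsf{while}\,C\,\mathsf{do}\,p$ be $\mathsf{while}\,C\,p\,\mathsf{skip}$. Fix $\rho:\mathbb N\to\text{programs}$, which resolves labels (it is irrelevant for programs without jumps). Program steps $\to$ on configurations (program, state) are defined inductively by: - $(\mathsf{basic}\,f,\sigma)\to(\mathsf{skip},f\sigma)$; - $(\mathsf{cjump}\,C\,i\,p,\sigma)\to(\rho\,i,\sigma)$ if $\sigma\in C$, and $\to(p,\sigma)$ otherwise; - $(\mathsf{if}\,C\,p\,q,\sigma)\to(p,\sigma)$ if $\sigma\in C$, and $\to(q,\sigma)$ otherwise; - $(w,\sigma)\to(p;\mathsf{skip};w,\sigma)$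 if $\sigma\in C$, and $\to(q,\sigma)$ otherwise, where $w=\mathsf{while}\,C\,p\,q$; - $(\mathsf{await}\,C\,p,\sigma)\to(\mathsf{skip},\sigma')$ if $\sigma\in C$ and $(p,\sigma)\to^*(\mathsf{skip},\sigma')$; - $(p;q,\sigma)\to(p';q,\sigma')$ if $(p,\sigma)\to(p',\sigma')$; and $(\mathsf{skip};q,\sigma)\to(q,\sigma)$; - $(\parallel(\dots,p_i,\dots),\sigma)\to(\parallel(\dots,p_i',\dots),\sigma')$ if $(p_i,\sigma)\to(p_i',\sigma')$; and $(\parallel(\mathsf{skip},\dots,\mathsf{skip}),\sigma)\to(\mathsf{skip},\sigma)$. An environment step relates configurations with equal program parts. A (finite non-empty or infinite) *computation of $p$* is a sequence of configurations whose first program part is $p$ and whose consecutive members are related by a program step or by an environment step. It has *stuttering environment* if its environment steps leave the state unchanged. *Redexes and fairness.* The set $\mathrm{Pos}\,p$ of redex positions, consisting of finite strings of natural numbers, is given by $\mathrm{Pos}\,\mathsf{skip}=\emptyset$; $\mathrm{Pos}(\mathsf{skip};q)=\{0\}$; $\mathrm{Pos}(p;q)=\{0x: x\in\mathrm{Pos}\,p\}$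 for $p\ne\mathsf{skip}$; $\mathrm{Pos}(\parallel(\mathsf{skip},\dots,\mathsf{skip}))=\{0\}$; $\mathrm{Pos}(\parallel(p_1,\dots,p_m))=\bigcup_{i=1}^m\{ix: x\in\mathrm{Pos}\,p_i\}$ otherwise; and $\mathrm{Pos}\,p=\{0\}$ for all other $p$. For $x\in\mathrm{Pos}\,p$, $p|_x$ is the subterm at $x$ (where $p|_0=p$, $(p;q)|_{0x}=p|_x$, $\parallel(p_1,\dots,p_m)|_{ix}=p_i|_x$), and $p[p']_x$ is $p$ with this subterm replaced by $p'$. A position $x\in\mathrm{Pos}\,p$ is *always available* if $p|_x=\mathsf{await}\,C\,p'$ implies that $C$ holds in all states and that for all $\sigma$ there is $\sigma'$ with $(p',\sigma)\to^*(\mathsf{skip},\sigma')$. An infinite computation $(p_i,\sigma_i)_{i\in\mathbb N}$ is *fair* if for all $i$ and every always available $x\in\mathrm{Pos}\,p_i$ there is $j\ge i$ with $x\in\mathrm{Pos}\,p_j$, $p_j|_x=p_i|_x$, $(p_j,\sigma_j)\to(p_{j+1},\sigma_{j+1})$, and some $p'$ with $p_{j+1}=p_j[p']_x$ and $(p_j|_x,\sigma_j)\to(p',\sigma_{j+1})$.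 *Conditions on programs.* Let $J(p)\subseteq\mathbb N$ be the least set that contains all labels occurring in $p$ and, for every $j\in J(p)$, all labels occurring in $\rho\,j$. The program $p$ is *sequential* if the parallel operator occurs neither in $p$ nor in any $\rho\,i$, $i\in J(p)$. It is *non-blocking* if all positions in $\mathrm{Pos}\,p$, and in $\mathrm{Pos}(\rho\,i)$ for every $i\in J(p)$, are always available. Programs $p$ and $q$ *correspond* w.r.t. a state relation $r$ if there is a relation $X\ni(p,q)$ on programs such that: whenever $(u,v)\in X$, $(\sigma_1,\sigma_2)\in r$ and $(v,\sigma_2)\to(v',\sigma_2')$, there is a step $(u,\sigma_1)\to(u',\sigma_1')$ with $(u',v')\in X$ and $(\sigma_1',\sigma_2')\in r$; $(\mathsf{skip},v)\in X$ implies $v=\mathsf{skip}$; and $(u,\mathsf{skip})\in X$ implies $u=\mathsf{skip}$. *The algorithm.* States consist of Boolean variables $flag_0,flag_1,turn,turn\_aux_0,turn\_aux_1$ and of variables $shared,local_0,local_1$ of arbitrary types. For programs $cs_0,cs_1$ on these states put $$\begin{aligned}\mathrm{thread}_0\,cs_0 &= flag_0:=\mathrm{True};\ turn:=\mathrm{True};\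 \mathsf{while}\,(flag_1\wedge turn)\,\mathsf{do}\,\mathsf{skip};\ cs_0;\ flag_0:=\mathrm{False},\\ \mathrm{thread}_1\,cs_1 &= flag_1:=\mathrm{True};\ turn:=\mathrm{False};\ \mathsf{while}\,(flag_0\wedge\neg turn)\,\mathsf{do}\,\mathsf{skip};\ cs_1;\ flag_1:=\mathrm{False},\end{aligned}$$ every assignment being a single $\mathsf{basic}$ step. Let $r_{eqv}$ relate two states iff they agree on $flag_0,flag_1,turn,shared,local_0,local_1$. **Proposition.** Assume that for each $k\in\{0,1\}$: 1. in every finite computation of $cs_k$ (with arbitrary environment steps and an arbitrary initial state) each program step leaves $flag_0,flag_1,turn,turn\_aux_0,turn\_aux_1$ unchanged; 2. every fair computation of $cs_k$ (with arbitrary environment steps) reaches a configuration with program part $\mathsf{skip}$; 3. $cs_k$ corresponds to itself w.r.t. $r_{eqv}$; 4. $cs_k$ is sequential and non-blocking. Then every fair computation of $\mathrm{thread}_0\,cs_0\parallel\mathrm{thread}_1\,cs_1$ with stuttering environment reaches a configuration with program part $\mathsf{skip}$. -/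

import Mathlib

namespace ConcImp

/-- Terms of the concurrent imperative language over states of type `α`.  State transformers
and state predicates are embedded shallowly; labels are natural numbers.  `par ps` is the flat
parallel composition of the non-empty finite sequence `ps 0, …, ps n`. -/
inductive Lang (α : Type*) : Type _
  | skip : Lang α
  | basic (f : α → α) : Lang α
  | cjump (C : Set α) (i : ℕ) (p : Lang α) : Lang α
  | while (C : Set α) (p q : Lang α) : Lang α
  | ite (C : Set α) (p q : Lang α) : Lang α
  | seq (p q : Lang α) : Lang α
  | par {n : ℕ} (ps : Fin (n + 1) → Lang α) : Lang α
  | await (C : Set α) (p : Lang α) : Lang α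

/-- A configuration: the program part and the state part. -/
abbrev Config (α : Type*) := Lang α × α

namespace Lang

variable {α : Type*}

/-- Sequential composition `p ;; q ;; r` abbreviates `p ;; (q ;; r)`. -/
scoped infixr:60 " ;; " => Lang.seq

/-- The binary parallel composition. -/
def par₂ (p q : Lang α) : Lang α := par ![p, q]

/-- The while-statement without a continuation. -/
def whileS (C : Set α) (p : Lang α) : Lang α := .while C p skip

/-- The labels that occur in a term. -/
def localJumps : Lang α → Set ℕ
  | skip => ∅
  | basic _ => ∅
  | cjump _ i p => insert i p.localJumps
  | .while _ p q => p.localJumps ∪ q.localJumps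
  | ite _ p q => p.localJumps ∪ q.localJumps
  | seq p q => p.localJumps ∪ q.localJumps
  | par ps => ⋃ i, (ps i).localJumps
  | await _ p => p.localJumps

/-- The parallel operator does not occur in the term. -/
def LocallySequential : Lang α → Prop
  | skip => True
  | basic _ => True
  | cjump _ _ p => p.LocallySequential
  | .while _ p q => p.LocallySequential ∧ q.LocallySequential
  | ite _ p q => p.LocallySequential ∧ q.LocallySequential
  | seq p q => p.LocallySequential ∧ q.LocallySequential
  | par _ => False
  | await _ p => p.LocallySequential

open Classical in
/-- The positions of the redexes of a term; the components of a parallel composition are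
numbered from `1`. -/
def pos : Lang α → Set (List ℕ)
  | skip => ∅
  | seq p _ => if p = skip then {[0]} else {x | ∃ y ∈ p.pos, x = 0 :: y}
  | par ps =>
      if ∀ i, ps i = skip then {[0]} else {x | ∃ i, ∃ y ∈ (ps i).pos, x = (i.val + 1) :: y}
  | _ => {[0]}

/-- The subterm at a position.  (Where the position does not exist, the value is irrelevant.) -/
def lookup : Lang α → List ℕ → Lang α
  | p, [0] => p
  | seq p _, 0 :: x => p.lookup x
  | @par _ n ps, (i + 1) :: x => if h : i < n + 1 then (ps ⟨i, h⟩).lookup x else skip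
  | _, _ => skip

/-- Replacement of the subterm at a position by `p'`.  (Where the position does not exist, the
value is irrelevant.) -/
def subst (p' : Lang α) : Lang α → List ℕ → Lang α
  | _, [0] => p'
  | seq p q, 0 :: x => seq (subst p' p x) q
  | @par _ n ps, (i + 1) :: x =>
      if h : i < n + 1 then par (Function.update ps ⟨i, h⟩ (subst p' (ps ⟨i, h⟩) x)) else skip
  | _, _ => skip

end Lang

open Lang

section Semantics

variable {α : Type*}

mutual

/-- Program steps in the context of a code retrieving function `ρ`. -/
inductive Step (ρ : ℕ → Lang α) : Config α → Config α → Prop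
  | basic (f : α → α) (σ : α) : Step ρ (.basic f, σ) (.skip, f σ)
  | cjump_true {C : Set α} {σ : α} (i : ℕ) (p : Lang α) (h : σ ∈ C) :
      Step ρ (.cjump C i p, σ) (ρ i, σ)
  | cjump_false {C : Set α} {σ : α} (i : ℕ) (p : Lang α) (h : σ ∉ C) :
      Step ρ (.cjump C i p, σ) (p, σ)
  | await {C : Set α} {σ σ' : α} {p : Lang α} (h : σ ∈ C)
      (hs : Steps ρ (p, σ) (.skip, σ')) :
      Step ρ (.await C p, σ) (.skip, σ')
  | ite_true {C : Set α} {σ : α} (p q : Lang α) (h : σ ∈ C) : Step ρ (.ite C p q, σ) (p, σ)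
  | ite_false {C : Set α} {σ : α} (p q : Lang α) (h : σ ∉ C) : Step ρ (.ite C p q, σ) (q, σ)
  | while_true {C : Set α} {σ : α} (p q : Lang α) (h : σ ∈ C) :
      Step ρ (.while C p q, σ) (p ;; .skip ;; .while C p q, σ)
  | while_false {C : Set α} {σ : α} (p q : Lang α) (h : σ ∉ C) :
      Step ρ (.while C p q, σ) (q, σ)
  | seq {p p' : Lang α} {σ σ' : α} (q : Lang α) (h : Step ρ (p, σ) (p', σ')) :
      Step ρ (p ;; q, σ) (p' ;; q, σ')
  | seq_skip (q : Lang α) (σ : α) : Step ρ (.skip ;; q, σ) (q, σ)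
  | par {n : ℕ} (ps : Fin (n + 1) → Lang α) (i : Fin (n + 1)) {p' : Lang α} {σ σ' : α}
      (h : Step ρ (ps i, σ) (p', σ')) :
      Step ρ (.par ps, σ) (.par (Function.update ps i p'), σ')
  | par_skip {n : ℕ} (ps : Fin (n + 1) → Lang α) (σ : α) (h : ∀ i, ps i = .skip) :
      Step ρ (.par ps, σ) (.skip, σ)

/-- Finitely many (possibly no) program steps: the reflexive transitive closure of `Step`. -/
inductive Steps (ρ : ℕ → Lang α) : Config α → Config α → Prop
  | refl (c : Config α) : Steps ρ c c
  | head {c c' c'' : Config α} (h : Step ρ c c') (hs : Steps ρ c' c'') : Steps ρ c c''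

end

theorem steps_iff_reflTransGen (ρ : ℕ → Lang α) (c c' : Config α) :
    Steps ρ c c' ↔ Relation.ReflTransGen (Step ρ) c c' := by
  constructor
  · exact go c c'
  · intro h
    induction h using Relation.ReflTransGen.head_induction_on with
    | refl => exact Steps.refl _
    | head h _ ih => exact Steps.head h ih
where
  go : ∀ c c' : Config α, Steps ρ c c' → Relation.ReflTransGen (Step ρ) c c'
    | _, _, .refl _ => .refl
    | _, _, .head h hs => .head h (go _ _ hs)

/-- Environment steps: the state may change arbitrarily, the program part may not. -/
def EnvStep (c c' : Config α) : Prop := c.1 = c'.1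

/-! ### Conditions on programs -/

/-- The labels that the labels in `L` directly lead to. -/
def nextJumps (ρ : ℕ → Lang α) (L : Set ℕ) : Set ℕ := {i | ∃ j ∈ L, i ∈ (ρ j).localJumps}

/-- All labels invoked by the program `(ρ, p)`. -/
def jumps (ρ : ℕ → Lang α) (p : Lang α) : Set ℕ := ⋃ n : ℕ, (nextJumps ρ)^[n] p.localJumps

/-- The program `(ρ, p)` is sequential. -/
def IsSequential (ρ : ℕ → Lang α) (p : Lang α) : Prop :=
  p.LocallySequential ∧ ∀ i ∈ jumps ρ p, (ρ i).LocallySequential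

/-- The position `x` of `p` is always available: an await-statement there never blocks. -/
def AlwaysAvailable (ρ : ℕ → Lang α) (p : Lang α) (x : List ℕ) : Prop :=
  ∀ (C : Set α) (p' : Lang α), p.lookup x = .await C p' →
    C = Set.univ ∧ ∀ σ, ∃ σ', Steps ρ (p', σ) (.skip, σ')

/-- All redexes of `p` are always available. -/
def LocallyNonBlocking (ρ : ℕ → Lang α) (p : Lang α) : Prop :=
  ∀ x ∈ p.pos, AlwaysAvailable ρ p x

/-- The program `(ρ, p)` is non-blocking. -/
def NonBlocking (ρ : ℕ → Lang α) (p : Lang α) : Prop :=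
  LocallyNonBlocking ρ p ∧ ∀ i ∈ jumps ρ p, LocallyNonBlocking ρ (ρ i)

/-! ### Program correspondence -/

/-- `X` is a simulation w.r.t. `ρ`, `ρ'` and the state relation `r`. -/
structure IsSimulation {β : Type*} (ρ : ℕ → Lang α) (ρ' : ℕ → Lang β) (r : α → β → Prop)
    (X : Lang α → Lang β → Prop) : Prop where
  step : ∀ p q σ₁ σ₂, X p q → r σ₁ σ₂ → ∀ q' σ₂', Step ρ' (q, σ₂) (q', σ₂') →
    ∃ p' σ₁', Step ρ (p, σ₁) (p', σ₁') ∧ X p' q' ∧ r σ₁' σ₂'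
  skip_left : ∀ q, X .skip q → q = .skip
  skip_right : ∀ p, X p .skip → p = .skip

/-- The programs `(ρ, p)` and `(ρ', q)` correspond w.r.t. the state relation `r`. -/
def Corresponds {β : Type*} (ρ : ℕ → Lang α) (ρ' : ℕ → Lang β) (r : α → β → Prop)
    (p : Lang α) (q : Lang β) : Prop :=
  ∃ X : Lang α → Lang β → Prop, X p q ∧ IsSimulation ρ ρ' r X

/-! ### Finite computations and extended Hoare triples -/

/-- `sq` is a finite potential computation of `(ρ, p)`, of length `n + 1`. -/
def IsFinComp (ρ : ℕ → Lang α) (p : Lang α) {n : ℕ} (sq : Fin (n + 1) → Config α) : Prop :=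
  (sq 0).1 = p ∧
    ∀ i : Fin n, Step ρ (sq i.castSucc) (sq i.succ) ∨ EnvStep (sq i.castSucc) (sq i.succ)

/-- The environment condition `R` on finite computations. -/
def FinEnvCond (R : α → α → Prop) {n : ℕ} (sq : Fin (n + 1) → Config α) : Prop :=
  ∀ i : Fin n, EnvStep (sq i.castSucc) (sq i.succ) → R (sq i.castSucc).2 (sq i.succ).2

/-- The program condition `G` on finite computations. -/
def FinProgCond (ρ : ℕ → Lang α) (G : α → α → Prop) {n : ℕ} (sq : Fin (n + 1) → Config α) :
    Prop :=
  ∀ i : Fin n, Step ρ (sq i.castSucc) (sq i.succ) → G (sq i.castSucc).2 (sq i.succ).2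

/-- The output condition `Q` on finite computations: the state of the first
`skip`-configuration, if there is one, satisfies `Q`. -/
def FinOutCond (Q : Set α) {n : ℕ} (sq : Fin (n + 1) → Config α) : Prop :=
  ∀ i, (sq i).1 = .skip → (∀ j < i, (sq j).1 ≠ .skip) → (sq i).2 ∈ Q

/-- The extended Hoare triple with rely `R`, precondition `P`, postcondition `Q` and
guarantee `G` for the program `(ρ, p)`. -/
def HoareTriple (ρ : ℕ → Lang α) (R : α → α → Prop) (P : Set α) (p : Lang α) (Q : Set α)
    (G : α → α → Prop) : Prop :=
  ∀ (n : ℕ) (sq : Fin (n + 1) → Config α),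
    FinEnvCond R sq → (sq 0).2 ∈ P → IsFinComp ρ p sq → FinOutCond Q sq ∧ FinProgCond ρ G sq

/-! ### Infinite and fair computations -/

/-- `sq` is an infinite potential computation of `(ρ, p)`. -/
def IsComp (ρ : ℕ → Lang α) (p : Lang α) (sq : ℕ → Config α) : Prop :=
  (sq 0).1 = p ∧ ∀ i, Step ρ (sq i) (sq (i + 1)) ∨ EnvStep (sq i) (sq (i + 1))

/-- The environment condition `R` on infinite computations. -/
def EnvCond (R : α → α → Prop) (sq : ℕ → Config α) : Prop :=
  ∀ i, EnvStep (sq i) (sq (i + 1)) → R (sq i).2 (sq (i + 1)).2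

/-- `sq` is a fair computation of `(ρ, p)`: every always available redex is eventually fired. -/
def IsFairComp (ρ : ℕ → Lang α) (p : Lang α) (sq : ℕ → Config α) : Prop :=
  IsComp ρ p sq ∧
    ∀ i, ∀ x ∈ (sq i).1.pos, AlwaysAvailable ρ (sq i).1 x →
      ∃ j ≥ i, x ∈ (sq j).1.pos ∧ (sq j).1.lookup x = (sq i).1.lookup x ∧
        Step ρ (sq j) (sq (j + 1)) ∧
        ∃ p' : Lang α, (sq (j + 1)).1 = Lang.subst p' (sq j).1 x ∧
          Step ρ ((sq j).1.lookup x, (sq j).2) (p', (sq (j + 1)).2)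

/-- `sq` is a fair computation of `(ρ, p)` that starts in `P` and never reaches `Q`. -/
def LiveCond (ρ : ℕ → Lang α) (sq : ℕ → Config α) (P : Set α) (p : Lang α) (Q : Set α) : Prop :=
  IsFairComp ρ p sq ∧ (sq 0).2 ∈ P ∧ ∀ i, (sq i).2 ∉ Q

/-- In addition, `sq` never reaches a `skip`-configuration. -/
def LiveCondN (ρ : ℕ → Lang α) (sq : ℕ → Config α) (P : Set α) (p : Lang α) (Q : Set α) : Prop :=
  LiveCond ρ sq P p Q ∧ ∀ i, (sq i).1 ≠ .skip

end Semantics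

/-! ### Peterson's mutual exclusion algorithm -/

/-- The states: protocol variables, auxiliary variables, and the variables of the critical
sections, whose types are left open. -/
structure PState (S L₀ L₁ : Type*) where
  flag₀ : Bool
  flag₁ : Bool
  turn : Bool
  turnAux₀ : Bool
  turnAux₁ : Bool
  shared : S
  local₀ : L₀
  local₁ : L₁

section Peterson

variable {S L₀ L₁ : Type*}

/-- The first thread, with critical section `cs₀`. -/
def thread₀ (cs₀ : Lang (PState S L₀ L₁)) : Lang (PState S L₀ L₁) :=
  .basic (fun σ => { σ with flag₀ := true }) ;;
  .basic (fun σ => { σ with turn := true }) ;;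
  whileS {σ | σ.flag₁ = true ∧ σ.turn = true} .skip ;;
  cs₀ ;;
  .basic (fun σ => { σ with flag₀ := false })

/-- The second thread, with critical section `cs₁`. -/
def thread₁ (cs₁ : Lang (PState S L₀ L₁)) : Lang (PState S L₀ L₁) :=
  .basic (fun σ => { σ with flag₁ := true }) ;;
  .basic (fun σ => { σ with turn := false }) ;;
  whileS {σ | σ.flag₀ = true ∧ ¬ σ.turn = true} .skip ;;
  cs₁ ;;
  .basic (fun σ => { σ with flag₁ := false })

/-- The auxiliary and the protocol variables are left unmodified. -/
def Gcs (σ σ' : PState S L₀ L₁) : Prop :=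
  σ.turnAux₀ = σ'.turnAux₀ ∧ σ.turnAux₁ = σ'.turnAux₁ ∧
  σ.flag₀ = σ'.flag₀ ∧ σ.flag₁ = σ'.flag₁ ∧ σ.turn = σ'.turn

/-- Equality of states up to the values of the auxiliary variables. -/
def rEqv (σ σ' : PState S L₀ L₁) : Prop :=
  σ.flag₀ = σ'.flag₀ ∧ σ.flag₁ = σ'.flag₁ ∧ σ.turn = σ'.turn ∧
  σ.shared = σ'.shared ∧ σ.local₀ = σ'.local₀ ∧ σ.local₁ = σ'.local₁

end Peterson

end ConcImp

open ConcImp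

namespace ConcImp

open Lang

section Computations

variable {α : Type*} {ρ : ℕ → Lang α}

/-! ### Inversion of program steps -/

theorem Step.not_skip {σ : α} {c : Config α} (h : Step ρ (.skip, σ) c) : False := by
  cases h

theorem Step.basic_inv {f : α → α} {σ : α} {c : Config α} (h : Step ρ (.basic f, σ) c) :
    c = (.skip, f σ) := by
  cases h
  rfl

theorem Step.seq_inv {p q : Lang α} {σ : α} {c : Config α} (h : Step ρ (p ;; q, σ) c) :
    (∃ p', c.1 = p' ;; q ∧ Step ρ (p, σ) (p', c.2)) ∨ (p = .skip ∧ c = (q, σ)) := by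
  cases h with
  | seq _ h => exact .inl ⟨_, rfl, h⟩
  | seq_skip => exact .inr ⟨rfl, rfl⟩

theorem Step.skip_seq_inv {q : Lang α} {σ : α} {c : Config α} (h : Step ρ (.skip ;; q, σ) c) :
    c = (q, σ) := by
  rcases h.seq_inv with ⟨_, _, h⟩ | ⟨_, h⟩
  · exact h.not_skip.elim
  · exact h

theorem Step.while_inv {C : Set α} {p q : Lang α} {σ : α} {c : Config α}
    (h : Step ρ (.while C p q, σ) c) :
    (σ ∈ C ∧ c = (p ;; .skip ;; .while C p q, σ)) ∨ (σ ∉ C ∧ c = (q, σ)) := by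
  cases h with
  | while_true _ _ h => exact .inl ⟨h, rfl⟩
  | while_false _ _ h => exact .inr ⟨h, rfl⟩

theorem Step.par_inv {n : ℕ} {ps : Fin (n + 1) → Lang α} {σ : α} {c : Config α}
    (h : Step ρ (.par ps, σ) c) :
    (∃ k p', c.1 = .par (Function.update ps k p') ∧ Step ρ (ps k, σ) (p', c.2)) ∨
      ((∀ k, ps k = .skip) ∧ c = (.skip, σ)) := by
  cases h with
  | par _ i h => exact .inl ⟨_, _, rfl, h⟩
  | par_skip _ _ h => exact .inr ⟨h, rfl⟩

theorem Lang.par_injective {n : ℕ} {ps qs : Fin (n + 1) → Lang α}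
    (h : Lang.par ps = Lang.par qs) : ps = qs := by
  cases h
  rfl

/-! ### Positions -/

@[simp] theorem Lang.lookup_root (p : Lang α) : p.lookup [0] = p := by
  cases p <;> simp [Lang.lookup]

@[simp] theorem Lang.subst_root (p' p : Lang α) : Lang.subst p' p [0] = p' := by
  cases p <;> simp [Lang.subst]

/-- `[0]` always denotes the root, so prefixing `0` descends into a sequential composition only in
front of a non-empty string. This fact excludes the collision. -/
theorem Lang.ne_nil_of_mem_pos {p : Lang α} {x : List ℕ} (h : x ∈ p.pos) : x ≠ [] := by
  rintro rfl
  cases p <;> simp only [Lang.pos] at h <;> try split_ifs at h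
  all_goals simp at h

theorem Lang.lookup_seq (p q : Lang α) {x : List ℕ} (h : x ≠ []) :
    (p ;; q).lookup (0 :: x) = p.lookup x := by
  cases x with
  | nil => exact absurd rfl h
  | cons a x => simp [Lang.lookup]

theorem Lang.subst_seq (p' p q : Lang α) {x : List ℕ} (h : x ≠ []) :
    Lang.subst p' (p ;; q) (0 :: x) = Lang.subst p' p x ;; q := by
  cases x with
  | nil => exact absurd rfl h
  | cons a x => simp [Lang.subst]

theorem Lang.lookup_par {n : ℕ} (ps : Fin (n + 1) → Lang α) (k : Fin (n + 1)) (x : List ℕ) :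
    (Lang.par ps).lookup ((k.val + 1) :: x) = (ps k).lookup x := by
  rw [Lang.lookup, dif_pos k.isLt]

theorem Lang.subst_par (p' : Lang α) {n : ℕ} (ps : Fin (n + 1) → Lang α) (k : Fin (n + 1))
    (x : List ℕ) :
    Lang.subst p' (Lang.par ps) ((k.val + 1) :: x) =
      Lang.par (Function.update ps k (Lang.subst p' (ps k) x)) := by
  rw [Lang.subst, dif_pos k.isLt]

theorem Lang.cons_mem_pos_seq {p q : Lang α} {x : List ℕ} (hp : p ≠ .skip) :
    0 :: x ∈ (p ;; q).pos ↔ x ∈ p.pos := by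
  simp [Lang.pos, hp]

theorem Lang.cons_mem_pos_par {n : ℕ} {ps : Fin (n + 1) → Lang α} {k : Fin (n + 1)}
    {x : List ℕ} : (k.val + 1) :: x ∈ (Lang.par ps).pos ↔ x ∈ (ps k).pos := by
  simp only [Lang.pos]
  split_ifs with h
  -- Both sides are false: the only position is `[0]`, components are numbered from 1, and `skip`
  -- has no redex.
  · simp [h k, Lang.pos]
  · constructor
    · rintro ⟨i, y, hy, he⟩
      simp only [List.cons.injEq, add_left_inj] at he
      obtain ⟨he, rfl⟩ := he
      rwa [Fin.ext he]
    · intro hx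
      exact ⟨k, x, hx, rfl⟩

/-- Firing a redex is a program step of the whole term. -/
theorem Step.subst {p : Lang α} {x : List ℕ} (hx : x ∈ p.pos) {p' : Lang α} {σ σ' : α}
    (h : Step ρ (p.lookup x, σ) (p', σ')) : Step ρ (p, σ) (Lang.subst p' p x, σ') := by
  induction p generalizing x with
  | skip => simp [Lang.pos] at hx
  | seq p q ihp _ =>
    by_cases hp : p = .skip
    · subst hp
      obtain rfl : x = [0] := by simpa [Lang.pos] using hx
      simpa using h
    · obtain ⟨y, hy, rfl⟩ : ∃ y ∈ p.pos, x = 0 :: y := by simpa [Lang.pos, hp] using hx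
      have hn := Lang.ne_nil_of_mem_pos hy
      rw [Lang.lookup_seq _ _ hn] at h
      rw [Lang.subst_seq _ _ _ hn]
      exact (ihp hy h).seq q
  | par ps ih =>
    by_cases hp : ∀ i, ps i = .skip
    · obtain rfl : x = [0] := by simpa [Lang.pos, hp] using hx
      simpa using h
    · obtain ⟨k, y, hy, rfl⟩ : ∃ i, ∃ y ∈ (ps i).pos, x = (i.val + 1) :: y := by
        simpa only [Lang.pos, if_neg hp, Set.mem_ofPred_eq] using hx
      rw [Lang.lookup_par] at h
      rw [Lang.subst_par]
      exact Step.par ps k (ih k hy h)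
  | _ =>
    obtain rfl : x = [0] := by simpa [Lang.pos] using hx
    simpa using h

/-! ### Fair computations -/

theorem IsFairComp.drop {p : Lang α} {sq : ℕ → Config α} (h : IsFairComp ρ p sq) (N : ℕ) :
    IsFairComp ρ (sq N).1 (fun i => sq (N + i)) := by
  refine ⟨⟨rfl, fun i => h.1.2 (N + i)⟩, fun i x hx ha => ?_⟩
  obtain ⟨j, hj, hf⟩ := h.2 (N + i) x hx ha
  obtain ⟨k, rfl⟩ := Nat.exists_eq_add_of_le (le_trans (Nat.le_add_right N i) hj)
  exact ⟨k, by omega, hf⟩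

/-- A redex at the root that cannot block is fired eventually. -/
theorem IsFairComp.fire_root {p : Lang α} {sq : ℕ → Config α} (h : IsFairComp ρ p sq) {i : ℕ}
    {u : Lang α} (hi : (sq i).1 = u) (hu : [0] ∈ u.pos) (ha : ∀ C p', u ≠ .await C p') :
    ∃ j ≥ i, (sq j).1 = u ∧ Step ρ (u, (sq j).2) (sq (j + 1)) := by
  subst hi
  obtain ⟨j, hj, -, hl, hs, -⟩ := h.2 i [0] hu fun C p' he => by
    rw [Lang.lookup_root] at he
    exact absurd he (ha C p')
  rw [Lang.lookup_root, Lang.lookup_root] at hl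
  refine ⟨j, hj, hl, ?_⟩
  rw [← hl]
  exact hs

/-- A fair computation of `p ;; q` either is a fair computation of `p` that never terminates,
or reaches a fair computation of `q`. -/
theorem IsFairComp.seq_cases {p q : Lang α} {sq : ℕ → Config α}
    (h : IsFairComp ρ (p ;; q) sq) :
    (∃ us : ℕ → Lang α, IsFairComp ρ p (fun i => (us i, (sq i).2)) ∧
      (∀ i, (sq i).1 = us i ;; q) ∧ ∀ i, us i ≠ .skip) ∨
    ∃ N, IsFairComp ρ q (fun i => sq (N + i)) := by
  -- Once `skip ;; q` occurs, fairness fires its root redex, which hands over to `q`. If it never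
  -- occurs, every program part has the form `u ;; q` with `u ≠ skip`, and the redexes of `u` are
  -- exactly those of `u ;; q` without the leading `0`.
  by_cases hs : ∃ i, (sq i).1 = .skip ;; q
  · obtain ⟨i, hi⟩ := hs
    obtain ⟨j, -, -, hj⟩ := h.fire_root hi (by simp [Lang.pos]) (by simp)
    have hd := h.drop (j + 1)
    rw [hj.skip_seq_inv] at hd
    exact .inr ⟨j + 1, hd⟩
  · push Not at hs
    have hex : ∀ i, ∃ u, (sq i).1 = u ;; q := by
      intro i
      induction i with
      | zero => exact ⟨p, h.1.1⟩
      | succ i ih =>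
        obtain ⟨u, hu⟩ := ih
        rcases h.1.2 i with hst | he
        · rw [← Prod.mk.eta (p := sq i), hu] at hst
          rcases hst.seq_inv with ⟨p', hp', _⟩ | ⟨rfl, _⟩
          · exact ⟨p', hp'⟩
          · exact absurd hu (hs i)
        · exact ⟨u, by rw [← hu]; exact Eq.symm he⟩
    choose us hus using hex
    have hne : ∀ i, us i ≠ .skip := fun i he => hs i (by rw [hus, he])
    have hst : ∀ i, Step ρ (sq i) (sq (i + 1)) →
        Step ρ (us i, (sq i).2) (us (i + 1), (sq (i + 1)).2) := by
      intro i hst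
      rw [← Prod.mk.eta (p := sq i), hus] at hst
      rcases hst.seq_inv with ⟨p', hp', h'⟩ | ⟨h', _⟩
      · rw [hus] at hp'
        injection hp' with hp'
        rwa [hp']
      · exact absurd h' (hne i)
    refine .inl ⟨us, ⟨⟨?_, fun i => ?_⟩, fun i x hx ha => ?_⟩, hus, hne⟩
    · have h0 := h.1.1
      rw [hus] at h0
      injection h0
    · rcases h.1.2 i with h' | h'
      · exact .inl (hst i h')
      · right
        have h'' : (sq i).1 = (sq (i + 1)).1 := h'
        rw [hus, hus] at h''
        injection h''
    · have hn := Lang.ne_nil_of_mem_pos hx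
      obtain ⟨j, hj, hxj, hl, hstep, p', hp', hf⟩ := h.2 i (0 :: x)
        (by rw [hus]; exact (Lang.cons_mem_pos_seq (hne i)).2 hx)
        (by
          intro C p' he
          rw [hus, Lang.lookup_seq _ _ hn] at he
          exact ha C p' he)
      rw [hus, Lang.lookup_seq _ _ hn, hus, Lang.lookup_seq _ _ hn] at hl
      rw [hus, Lang.lookup_seq _ _ hn] at hf
      rw [hus, hus, Lang.subst_seq _ _ _ hn] at hp'
      rw [hus, Lang.cons_mem_pos_seq (hne j)] at hxj
      injection hp' with hp'
      exact ⟨j, hj, hxj, hl, hst j hstep, p', hp', hf⟩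

theorem IsFairComp.basic_terminates {f : α → α} {sq : ℕ → Config α}
    (h : IsFairComp ρ (.basic f) sq) : ∃ N σ, sq N = (.skip, f σ) := by
  obtain ⟨j, -, -, hj⟩ := h.fire_root h.1.1 (by simp [Lang.pos]) (by simp)
  exact ⟨j + 1, _, hj.basic_inv⟩

/-- A sequential composition whose first part terminates reaches its second part. -/
theorem IsFairComp.seq_right {p q : Lang α} {sq : ℕ → Config α}
    (h : IsFairComp ρ (p ;; q) sq)
    (hp : ∀ sq', IsFairComp ρ p sq' → ∃ i, (sq' i).1 = .skip) :
    ∃ N, IsFairComp ρ q (fun i => sq (N + i)) := by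
  rcases h.seq_cases with ⟨us, hus, -, hne⟩ | h
  · obtain ⟨i, hi⟩ := hp _ hus
    exact absurd hi (hne i)
  · exact h

theorem IsFairComp.basic_seq_right {f : α → α} {q : Lang α} {sq : ℕ → Config α}
    (h : IsFairComp ρ (.basic f ;; q) sq) : ∃ N, IsFairComp ρ q (fun i => sq (N + i)) :=
  h.seq_right fun _ h' => by
    obtain ⟨N, σ, hN⟩ := h'.basic_terminates
    exact ⟨N, by rw [hN]⟩

/-! ### Idle loops -/

/-- The programs that occur in an execution of `whileS C skip`. -/
def IdleLoop (C : Set α) (p : Lang α) : Prop :=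
  p = whileS C .skip ∨ p = .skip ;; .skip ;; whileS C .skip ∨
    p = .skip ;; whileS C .skip ∨ p = .skip

theorem IdleLoop.step {C : Set α} {p : Lang α} (hp : IdleLoop C p) {σ : α} {c : Config α}
    (h : Step ρ (p, σ) c) : IdleLoop C c.1 ∧ c.2 = σ := by
  rcases hp with rfl | rfl | rfl | rfl
  · rcases Step.while_inv h with ⟨-, rfl⟩ | ⟨-, rfl⟩
    · exact ⟨.inr (.inl rfl), rfl⟩
    · exact ⟨.inr (.inr (.inr rfl)), rfl⟩
  · rw [h.skip_seq_inv]
    exact ⟨.inr (.inr (.inl rfl)), rfl⟩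
  · rw [h.skip_seq_inv]
    exact ⟨.inl rfl, rfl⟩
  · exact h.not_skip.elim

theorem IsComp.idleLoop {C : Set α} {sq : ℕ → Config α} (h : IsComp ρ (whileS C .skip) sq)
    (i : ℕ) : IdleLoop C (sq i).1 := by
  induction i with
  | zero => exact .inl h.1
  | succ i ih =>
    rcases h.2 i with hs | he
    · exact (ih.step hs).1
    · rwa [← show (sq i).1 = (sq (i + 1)).1 from he]

/-- A fair computation of `whileS C skip` that does not terminate meets `C` again and again. -/
theorem IsFairComp.idleLoop_frequently {C : Set α} {sq : ℕ → Config α}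
    (h : IsFairComp ρ (whileS C .skip) sq) (hne : ∀ i, (sq i).1 ≠ .skip) (i : ℕ) :
    ∃ j ≥ i, (sq j).2 ∈ C := by
  -- The loop test is fired at some later time; were the state outside `C` then, the loop would exit
  -- to `skip`. The other forms of the loop lead back to this one after one or two `skip` redexes.
  have h1 : ∀ i, (sq i).1 = whileS C .skip → ∃ j ≥ i, (sq j).2 ∈ C := by
    intro i hi
    obtain ⟨j, hj, -, hs⟩ := h.fire_root hi (by simp [whileS, Lang.pos]) (by simp [whileS])
    rcases Step.while_inv hs with ⟨hC, -⟩ | ⟨-, he⟩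
    · exact ⟨j, hj, hC⟩
    · exact absurd (congrArg Prod.fst he) (hne _)
  have h2 : ∀ i, (sq i).1 = .skip ;; whileS C .skip → ∃ j ≥ i, (sq j).2 ∈ C := by
    intro i hi
    obtain ⟨j, hj, -, hs⟩ := h.fire_root hi (by simp [Lang.pos]) (by simp)
    obtain ⟨k, hk, hC⟩ := h1 (j + 1) (by rw [hs.skip_seq_inv])
    exact ⟨k, by omega, hC⟩
  rcases h.1.idleLoop i with hi | hi | hi | hi
  · exact h1 i hi
  · obtain ⟨j, hj, -, hs⟩ := h.fire_root hi (by simp [Lang.pos]) (by simp)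
    obtain ⟨k, hk, hC⟩ := h2 (j + 1) (by rw [hs.skip_seq_inv])
    exact ⟨k, by omega, hC⟩
  · exact h2 i hi
  · exact absurd hi (hne i)

/-! ### Guarantees -/

/-- `p'` can be reached from `p` by program steps if the environment may change the state
arbitrarily. -/
def Reach (ρ : ℕ → Lang α) : Lang α → Lang α → Prop :=
  Relation.ReflTransGen fun p p' => ∃ σ σ', Step ρ (p, σ) (p', σ')

/-- All program steps of computations of `p` satisfy `G`. -/
def Guarantees (ρ : ℕ → Lang α) (G : α → α → Prop) (p : Lang α) : Prop :=
  ∀ p', Reach ρ p p' → ∀ p'' σ σ', Step ρ (p', σ) (p'', σ') → G σ σ'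

theorem IsComp.reach {p : Lang α} {sq : ℕ → Config α} (h : IsComp ρ p sq) (i : ℕ) :
    Reach ρ p (sq i).1 := by
  induction i with
  | zero => rw [h.1]; exact .refl
  | succ i ih =>
    rcases h.2 i with hs | he
    · exact ih.tail ⟨_, _, hs⟩
    · rwa [← show (sq i).1 = (sq (i + 1)).1 from he]

theorem Guarantees.comp {G : α → α → Prop} {p : Lang α} (hG : Guarantees ρ G p)
    {sq : ℕ → Config α} (h : IsComp ρ p sq) {i : ℕ} (hs : Step ρ (sq i) (sq (i + 1))) :
    G (sq i).2 (sq (i + 1)).2 :=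
  hG _ (h.reach i) _ _ _ hs

theorem IsFinComp.snoc {p : Lang α} {n : ℕ} {sq : Fin (n + 1) → Config α}
    (h : IsFinComp ρ p sq) {c : Config α}
    (hc : Step ρ (sq (Fin.last n)) c ∨ EnvStep (sq (Fin.last n)) c) :
    IsFinComp ρ p (Fin.snoc (α := fun _ => Config α) sq c) := by
  refine ⟨?_, fun i => ?_⟩
  · rw [← Fin.castSucc_zero, Fin.snoc_castSucc]
    exact h.1
  · induction i using Fin.lastCases with
    | last => simpa only [Fin.snoc_castSucc, Fin.succ_last, Fin.snoc_last] using hc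
    | cast i => simpa only [Fin.snoc_castSucc, ← Fin.castSucc_succ] using h.2 i

/-- Consecutive steps in `Reach` need not agree on states. An environment step inserted after each
program step repairs this, which is why the final state `σ` can be arbitrary. -/
theorem Reach.exists_finComp {p p' : Lang α} (h : Reach ρ p p') (σ : α) :
    ∃ (n : ℕ) (sq : Fin (n + 1) → Config α),
      IsFinComp ρ p sq ∧ sq (Fin.last n) = (p', σ) := by
  induction h generalizing σ with
  | refl => exact ⟨0, fun _ => (p, σ), ⟨rfl, fun i => i.elim0⟩, rfl⟩
  | tail _ hs ih =>
    obtain ⟨τ, τ', hs⟩ := hs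
    obtain ⟨n, sq, hsq, hl⟩ := ih τ
    have h1 := hsq.snoc (.inl (hl ▸ hs))
    have h2 := h1.snoc (c := (_, σ)) (.inr (by rw [Fin.snoc_last]; exact rfl))
    exact ⟨_, _, h2, Fin.snoc_last _ _⟩

theorem HoareTriple.guarantees {G : α → α → Prop} {p : Lang α} {Q : Set α}
    (h : HoareTriple ρ ⊤ Set.univ p Q G) : Guarantees ρ G p := by
  intro p' hr p'' σ σ' hs
  obtain ⟨n, sq, hsq, hl⟩ := hr.exists_finComp σ
  -- The given step is appended to a finite computation that leads to it, and the program condition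
  -- is read off at the last index.
  have hg := (h _ _ (fun _ _ => trivial) trivial (hsq.snoc (.inl (hl ▸ hs)))).2 (Fin.last n)
  simp only [Fin.snoc_castSucc, Fin.succ_last, Fin.snoc_last, hl] at hg
  exact hg hs

theorem Guarantees.mono {G G' : α → α → Prop} {p : Lang α} (h : Guarantees ρ G p)
    (hG : ∀ σ σ', G σ σ' → G' σ σ') : Guarantees ρ G' p :=
  fun p' hr p'' σ σ' hs => hG _ _ (h p' hr p'' σ σ' hs)

theorem Guarantees.basic {G : α → α → Prop} {f : α → α} (h : ∀ σ, G σ (f σ)) :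
    Guarantees ρ G (.basic f) := by
  have hr : ∀ p', Reach ρ (.basic f) p' → p' = .basic f ∨ p' = .skip := by
    intro p' hr
    induction hr with
    | refl => exact .inl rfl
    | tail _ hs ih =>
      obtain ⟨_, _, hs⟩ := hs
      rcases ih with rfl | rfl
      · exact .inr (congrArg Prod.fst hs.basic_inv)
      · exact hs.not_skip.elim
  intro p' hp' p'' σ σ' hs
  rcases hr p' hp' with rfl | rfl
  · cases hs
    exact h σ
  · exact hs.not_skip.elim

/-- Reflexivity of `G` accounts for the step from `skip ;; q` to `q`, which belongs to neither part.
-/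
theorem Guarantees.seq {G : α → α → Prop} {p q : Lang α} (hG : ∀ σ, G σ σ)
    (hp : Guarantees ρ G p) (hq : Guarantees ρ G q) : Guarantees ρ G (p ;; q) := by
  have hr : ∀ u, Reach ρ (p ;; q) u → (∃ p', u = p' ;; q ∧ Reach ρ p p') ∨ Reach ρ q u := by
    intro u hr
    induction hr with
    | refl => exact .inl ⟨p, rfl, .refl⟩
    | tail _ hs ih =>
      obtain ⟨σ, σ', hs⟩ := hs
      rcases ih with ⟨p', rfl, hp'⟩ | ih
      · rcases hs.seq_inv with ⟨p'', he, h'⟩ | ⟨-, he⟩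
        · exact .inl ⟨p'', he, hp'.tail ⟨_, _, h'⟩⟩
        · right
          obtain rfl : _ = q := congrArg Prod.fst he
          exact .refl
      · exact .inr (ih.tail ⟨_, _, hs⟩)
  intro u hu u' σ σ' hs
  rcases hr u hu with ⟨p', rfl, hp'⟩ | hu
  · rcases hs.seq_inv with ⟨p'', -, h'⟩ | ⟨-, he⟩
    · exact hp _ hp' _ _ _ h'
    · rw [show σ' = σ from congrArg Prod.snd he]
      exact hG σ
  · exact hq _ hu _ _ _ hs

theorem Guarantees.idleLoop {G : α → α → Prop} (hG : ∀ σ, G σ σ) (C : Set α) :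
    Guarantees ρ G (whileS C .skip) := by
  have hr : ∀ u, Reach ρ (whileS C .skip) u → IdleLoop C u := by
    intro u hr
    induction hr with
    | refl => exact .inl rfl
    | tail _ hs ih =>
      obtain ⟨σ, σ', hs⟩ := hs
      exact (ih.step hs).1
  intro u hu u' σ σ' hs
  rw [show σ' = σ from ((hr u hu).step hs).2]
  exact hG σ

/-! ### Computations of parallel compositions -/

section Par

variable {n : ℕ} {ps : ℕ → Fin (n + 1) → Lang α} {p : Lang α} {sq : ℕ → Config α}

theorem exists_step_component (hps : ∀ i, (sq i).1 = .par (ps i)) {i : ℕ}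
    (h : Step ρ (sq i) (sq (i + 1))) :
    ∃ k, Step ρ (ps i k, (sq i).2) (ps (i + 1) k, (sq (i + 1)).2) ∧
      ∀ l ≠ k, ps (i + 1) l = ps i l := by
  rw [← Prod.mk.eta (p := sq i), hps] at h
  rcases h.par_inv with ⟨k, p', hp', hs⟩ | ⟨-, he⟩
  · rw [hps] at hp'
    have hp' := Lang.par_injective hp'
    refine ⟨k, ?_, fun l hl => ?_⟩
    · rw [hp', Function.update_self]
      exact hs
    · rw [hp', Function.update_of_ne hl]
  · have := hps (i + 1)
    rw [he] at this
    cases this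

/-- The components of a fair computation of a parallel composition are fair. -/
theorem IsFairComp.component (h : IsFairComp ρ p sq) (hps : ∀ i, (sq i).1 = .par (ps i))
    (k : Fin (n + 1)) : IsFairComp ρ (ps 0 k) (fun i => (ps i k, (sq i).2)) := by
  refine ⟨⟨rfl, fun i => ?_⟩, fun i x hx ha => ?_⟩
  · rcases h.1.2 i with hs | he
    · obtain ⟨l, hl, hne⟩ := exists_step_component hps hs
      by_cases hkl : k = l
      · subst hkl
        exact .inl hl
      · exact .inr (hne k hkl).symm
    · right
      have he : (sq i).1 = (sq (i + 1)).1 := he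
      rw [hps, hps] at he
      exact congrFun (Lang.par_injective he) k
  · obtain ⟨j, hj, hxj, hl, -, p', hp', hf⟩ := h.2 i ((k.val + 1) :: x)
      (by rw [hps]; exact Lang.cons_mem_pos_par.2 hx)
      (by
        intro C p' he
        rw [hps, Lang.lookup_par] at he
        exact ha C p' he)
    rw [hps, Lang.lookup_par, hps, Lang.lookup_par] at hl
    rw [hps, Lang.lookup_par] at hf
    rw [hps, Lang.cons_mem_pos_par] at hxj
    rw [hps, hps, Lang.subst_par] at hp'
    have hk : ps (j + 1) k = Lang.subst p' (ps j k) x := by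
      rw [Lang.par_injective hp', Function.update_self]
    -- The step of the whole term does not reveal which component moved; the firing of the redex
    -- does, and it lifts to a step of component `k`.
    refine ⟨j, hj, hxj, hl, ?_, p', hk, hf⟩
    simp only [hk]
    exact Step.subst hxj hf

/-- If the environment stutters, then every change of the state is due to a component. -/
theorem IsFairComp.exists_component_of_ne (h : IsFairComp ρ p sq)
    (hps : ∀ i, (sq i).1 = .par (ps i)) (henv : EnvCond (fun σ σ' => σ = σ') sq) {i : ℕ}
    (hi : (sq (i + 1)).2 ≠ (sq i).2) :
    ∃ k, Step ρ (ps i k, (sq i).2) (ps (i + 1) k, (sq (i + 1)).2) := by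
  rcases h.1.2 i with hs | he
  · obtain ⟨k, hk, -⟩ := exists_step_component hps hs
    exact ⟨k, hk⟩
  · exact absurd (henv i he).symm hi

theorem IsFairComp.exists_par (h : IsFairComp ρ (.par (ps 0)) sq)
    (hne : ∀ i, (sq i).1 ≠ .skip) : ∃ qs : ℕ → Fin (n + 1) → Lang α,
      (∀ i, (sq i).1 = .par (qs i)) := by
  suffices ∀ i, ∃ qs : Fin (n + 1) → Lang α, (sq i).1 = .par qs by
    choose qs hqs using this
    exact ⟨qs, hqs⟩
  intro i
  induction i with
  | zero => exact ⟨_, h.1.1⟩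
  | succ i ih =>
    obtain ⟨qs, hqs⟩ := ih
    rcases h.1.2 i with hs | he
    · rw [← Prod.mk.eta (p := sq i), hqs] at hs
      rcases hs.par_inv with ⟨k, p', hp', -⟩ | ⟨-, he⟩
      · exact ⟨_, hp'⟩
      · exact absurd (congrArg Prod.fst he) (hne _)
    · exact ⟨qs, by rw [← hqs]; exact Eq.symm he⟩

end Par

/-! ### Threads with a waiting loop -/

theorem IsComp.skip_of_le {p : Lang α} {sq : ℕ → Config α} (h : IsComp ρ p sq) {N i : ℕ}
    (hN : (sq N).1 = .skip) (hi : N ≤ i) : (sq i).1 = .skip := by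
  induction i, hi using Nat.le_induction with
  | base => exact hN
  | succ i _ ih =>
    rcases h.2 i with hs | he
    · rw [← Prod.mk.eta (p := sq i), ih] at hs
      exact hs.not_skip.elim
    · rw [← ih]
      exact Eq.symm he

/-- From index `N` on, `sq` is in a waiting loop with the condition `C`. -/
def WaitsFrom (ρ : ℕ → Lang α) (C : Set α) (sq : ℕ → Config α) (N : ℕ) : Prop :=
  (∀ i ≥ N, Step ρ (sq i) (sq (i + 1)) → (sq (i + 1)).2 = (sq i).2) ∧
    ∀ i ≥ N, ∃ j ≥ i, (sq j).2 ∈ C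

/-- A thread that enters its terminating critical section through a waiting loop either waits
forever, or terminates with its last assignment. -/
theorem IsFairComp.waits_or_terminates {f g h : α → α} {C : Set α} {cs : Lang α}
    {sq : ℕ → Config α}
    (hsq : IsFairComp ρ (.basic f ;; .basic g ;; whileS C .skip ;; cs ;; .basic h) sq)
    (hcs : ∀ sq', IsFairComp ρ cs sq' → ∃ i, (sq' i).1 = .skip) :
    (∃ N, WaitsFrom ρ C sq N) ∨ ∃ N σ, sq N = (.skip, h σ) := by
  obtain ⟨a, ha⟩ := hsq.basic_seq_right
  obtain ⟨b, hb⟩ := ha.basic_seq_right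
  -- The loop is the only part that may fail to terminate, so this is where the two alternatives
  -- split.
  rcases hb.seq_cases with ⟨us, hus, heq, hne⟩ | ⟨c, hc⟩
  · refine .inl ⟨a + b, fun i hi hs => ?_, fun i hi => ?_⟩
    · obtain ⟨i, rfl⟩ := Nat.exists_eq_add_of_le hi
      have hl := hus.1.idleLoop i
      have hq := heq i
      simp only [← add_assoc] at hl hq
      rw [← Prod.mk.eta (p := sq (a + b + i)), hq] at hs
      rcases hs.seq_inv with ⟨p', -, h'⟩ | ⟨h', -⟩
      · exact (hl.step h').2
      · exact absurd h' (hne i)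
    · obtain ⟨i, rfl⟩ := Nat.exists_eq_add_of_le hi
      obtain ⟨j, hj, hC⟩ := hus.idleLoop_frequently hne i
      simp only [← add_assoc] at hC
      exact ⟨a + b + j, by omega, hC⟩
  · obtain ⟨d, hd⟩ := hc.seq_right hcs
    obtain ⟨N, σ, hN⟩ := hd.basic_terminates
    exact .inr ⟨_, σ, hN⟩

end Computations

-- Neither thread writes the flag of the other

section Peterson

variable {S L₀ L₁ : Type*} {ρ : ℕ → Lang (PState S L₀ L₁)} {cs : Lang (PState S L₀ L₁)}

theorem guarantees_thread₀ (h : HoareTriple ρ ⊤ Set.univ cs Set.univ Gcs) :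
    Guarantees ρ (fun σ σ' => σ'.flag₁ = σ.flag₁) (thread₀ cs) := by
  have hG : ∀ σ : PState S L₀ L₁, σ.flag₁ = σ.flag₁ := fun _ => rfl
  exact .seq hG (.basic hG) <| .seq hG (.basic hG) <| .seq hG (.idleLoop hG _) <|
    .seq hG (h.guarantees.mono fun _ _ hg => hg.2.2.2.1.symm) (.basic hG)

theorem guarantees_thread₁ (h : HoareTriple ρ ⊤ Set.univ cs Set.univ Gcs) :
    Guarantees ρ (fun σ σ' => σ'.flag₀ = σ.flag₀) (thread₁ cs) := by
  have hG : ∀ σ : PState S L₀ L₁, σ.flag₀ = σ.flag₀ := fun _ => rfl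
  exact .seq hG (.basic hG) <| .seq hG (.basic hG) <| .seq hG (.idleLoop hG _) <|
    .seq hG (h.guarantees.mono fun _ _ hg => hg.2.2.1.symm) (.basic hG)

end Peterson

end ConcImp

-- Termination of Peterson's algorithm

open ConcImp
theorem mainTheorem6 {S L₀ L₁ : Type*} (ρ : ℕ → Lang (PState S L₀ L₁))
    (cs₀ cs₁ : Lang (PState S L₀ L₁))
    (h1 : HoareTriple ρ ⊤ Set.univ cs₀ Set.univ Gcs)
    (h2 : HoareTriple ρ ⊤ Set.univ cs₁ Set.univ Gcs)
    (h3 : ∀ (sq : ℕ → Config (PState S L₀ L₁)) (P : Set (PState S L₀ L₁)),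
      ¬ LiveCondN ρ sq P cs₀ ∅)
    (h4 : ∀ (sq : ℕ → Config (PState S L₀ L₁)) (P : Set (PState S L₀ L₁)),
      ¬ LiveCondN ρ sq P cs₁ ∅)
    (h5 : Corresponds ρ ρ rEqv cs₀ cs₀)
    (h6 : Corresponds ρ ρ rEqv cs₁ cs₁)
    (h7 : (IsSequential ρ cs₀ ∧ NonBlocking ρ cs₀) ∧ (IsSequential ρ cs₁ ∧ NonBlocking ρ cs₁))
    (sq : ℕ → Config (PState S L₀ L₁))
    (hfair : IsFairComp ρ (Lang.par₂ (thread₀ cs₀) (thread₁ cs₁)) sq)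
    (henv : EnvCond (fun σ σ' => σ = σ') sq) :
    ∃ i, (sq i).1 = Lang.skip := by
  by_contra! hne
  have hterm : ∀ cs : Lang (PState S L₀ L₁),
      (∀ (sq : ℕ → Config (PState S L₀ L₁)) (P : Set (PState S L₀ L₁)),
        ¬ LiveCondN ρ sq P cs ∅) →
      ∀ sq', IsFairComp ρ cs sq' → ∃ i, (sq' i).1 = Lang.skip := by
    intro cs h sq' hsq'
    by_contra! hn
    -- The precondition `Set.univ` and the target `∅` impose nothing, so only fairness and
    -- non-termination remain.
    exact h sq' Set.univ ⟨⟨hsq', trivial, fun _ => id⟩, hn⟩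
  -- Only the value at `0` of the given family matters, so a constant one serves.
  obtain ⟨ps, hps⟩ := IsFairComp.exists_par
    (ps := fun _ => ![thread₀ cs₀, thread₁ cs₁]) hfair hne
  have hps0 : ps 0 = ![thread₀ cs₀, thread₁ cs₁] :=
    Lang.par_injective ((hps 0).symm.trans hfair.1.1)
  have c₀ := hfair.component hps 0
  have c₁ := hfair.component hps 1
  rw [show ps 0 0 = thread₀ cs₀ by rw [hps0]; rfl] at c₀
  rw [show ps 0 1 = thread₁ cs₁ by rw [hps0]; rfl] at c₁
  have hstep := fun i => hfair.exists_component_of_ne hps henv (i := i)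
  rcases c₀.waits_or_terminates (hterm _ h3) with ⟨M, hM⟩ | ⟨M, σ, hM⟩ <;>
    rcases c₁.waits_or_terminates (hterm _ h4) with ⟨N, hN⟩ | ⟨N, τ, hN⟩
  · have hconst : ∀ i ≥ max M N, (sq i).2 = (sq (max M N)).2 := by
      intro i hi
      induction i, hi using Nat.le_induction with
      | base => rfl
      | succ i hi ih =>
        rw [← ih]
        by_contra hc
        obtain ⟨k, hk⟩ := hstep i hc
        fin_cases k
        · exact hc (hM.1 i (le_trans (le_max_left _ _) hi) hk)
        · exact hc (hN.1 i (le_trans (le_max_right _ _) hi) hk)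
    obtain ⟨i, hi, hC₀⟩ := hM.2 (max M N) (le_max_left _ _)
    obtain ⟨j, hj, hC₁⟩ := hN.2 (max M N) (le_max_right _ _)
    simp only [hconst i hi, hconst j hj] at hC₀ hC₁
    exact hC₁.2 hC₀.2
  -- Thread 0 waits and thread 1 has ended by lowering `flag₁`. Afterwards only thread 0 can step,
  -- and it never writes `flag₁`; the case after this one is symmetric.
  · have hflag : ∀ i ≥ N, (sq i).2.flag₁ = false := by
      intro i hi
      induction i, hi using Nat.le_induction with
      | base => exact congrArg (fun c => c.2.flag₁) hN
      | succ i hi ih =>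
        rw [← ih]
        by_contra hc
        obtain ⟨k, hk⟩ := hstep i fun he => hc (by rw [he])
        fin_cases k
        · exact hc ((guarantees_thread₀ h1).comp c₀.1 hk)
        · have hs := c₁.1.skip_of_le (congrArg Prod.fst hN) hi
          rw [show ps i ⟨1, by omega⟩ = .skip from hs] at hk
          exact hk.not_skip
    obtain ⟨i, hi, hC⟩ := hM.2 (max M N) (le_max_left _ _)
    have := hflag i (le_trans (le_max_right _ _) hi)
    exact Bool.false_ne_true (this.symm.trans hC.1)
  · have hflag : ∀ i ≥ M, (sq i).2.flag₀ = false := by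
      intro i hi
      induction i, hi using Nat.le_induction with
      | base => exact congrArg (fun c => c.2.flag₀) hM
      | succ i hi ih =>
        rw [← ih]
        by_contra hc
        obtain ⟨k, hk⟩ := hstep i fun he => hc (by rw [he])
        fin_cases k
        · have hs := c₀.1.skip_of_le (congrArg Prod.fst hM) hi
          rw [show ps i ⟨0, by omega⟩ = .skip from hs] at hk
          exact hk.not_skip
        · exact hc ((guarantees_thread₁ h2).comp c₁.1 hk)
    obtain ⟨i, hi, hC⟩ := hN.2 (max M N) (le_max_right _ _)
    have := hflag i (le_trans (le_max_left _ _) hi)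
    exact Bool.false_ne_true (this.symm.trans hC.1)
  -- Both threads have terminated, so fairness at the root forces the step to `skip`.
  · have hs₀ := c₀.1.skip_of_le (congrArg Prod.fst hM) (le_max_left M N)
    have hs₁ := c₁.1.skip_of_le (congrArg Prod.fst hN) (le_max_right M N)
    have hall : ∀ k, ps (max M N) k = .skip := by
      intro k
      fin_cases k
      · exact hs₀
      · exact hs₁
    obtain ⟨j, -, -, hj⟩ := hfair.fire_root (hps (max M N))
      (by simp [Lang.pos, hall]) (by simp)
    rcases hj.par_inv with ⟨k, p', -, hk⟩ | ⟨-, he⟩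
    · rw [hall k] at hk
      exact hk.not_skip
    · exact hne _ (congrArg Prod.fst he)
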